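/- Let $\Sigma$ be a finite or countable totally ordered set with a sign map $\|\cdot\|:\Sigma\to\mathbb Z_2$. The super plactic monoid $\mathbf P(\Sigma)$ is the quotient of the free monoid $\Sigma^*$ by the congruence generated by the following relations, for all $x\le y\le z$ in $\Sigma$: $$zxy = xzy \quad\text{if } (x=y\Rightarrow\|y\|=0) \text{ and } (y=z\Rightarrow\|y\|=1),$$ $$yzx = yxz \quad\text{if } (x=y\Rightarrow\|y\|=1) \text{ and } (y=z\Rightarrow\|y\|=0).$$ A super tableau is a filling of a (possibly empty) left-justified Young diagram by elements of $\Sigma$ whose rows weakly increase from left to right, two adjacent entries of a row being equal only if their sign is $0$, and whose columns weakly increase from top to bottom, two adjacent entries of a column being equal only if their sign is $1$. The insertion tableau of a word is obtained from the empty tableau by inserting its letters successively from left to right. To insert a letter $x$, start with the top row: $x$ replaces the leftmost entry $y$ of the row with $y>x$ if $\|x\|=0$ (with $y\ge x$ if $\|x\|=1$), and $y$ is then inserted in the next row in the same way; if there is no such entry, $x$ is put at the right end of the row. A super column is a nonempty word $x_1\cdots x_k$ over $\Sigma$ with $x_{i+1}\le x_i$, and $x_{i+1}=x_i$ only if $\|x_i\|=1$;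 it is identified with the one-column super tableau that it reads from bottom to top. Let $\mathrm{Colo}_2(\Sigma)$ be the $2$-polygraph (string rewriting system) with one generator $c_u$ for each super column $u$, and one rule for each pair of super columns $(u,v)$ such that placing the column $v$ to the right of the column $u$, with tops aligned, does not give a super tableau. The target of the rule with source $c_uc_v$ is the product of the generators of the columns of the insertion tableau of $uv$, taken from left to right and read from bottom to top. **Theorem.** (1) For each such pair $(u,v)$, the insertion tableau of $uv$ either has exactly one column, with reading $uv$, or exactly two columns, with readings $w$ and $w'$. So the rules have the form $c_uc_v\Rightarrow c_{uv}$ or $c_uc_v\Rightarrow c_wc_{w'}$. (2) $\mathrm{Colo}_2(\Sigma)$ is convergent: it has no infinite rewriting sequence, and any two finite rewriting sequences with the same source can be continued by finite rewriting sequences to a common target. (3) $\mathrm{Colo}_2(\Sigma)$ is a presentation of $\mathbf P(\Sigma)$: the quotient of the free monoid on the generators $c_u$ by the congruence generated by the rules is isomorphic to $\mathbf P(\Sigma)$, by an isomorphism that sends $c_u$ to the class of the word $u$ for every super column $u$. -/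

import Mathlib

universe u v

/-! ## Presentations of monoids by 2-polygraphs (with one 0-cell) -/

/-- A `2`-polygraph with a single `0`-cell: a set of generating `1`-cells, and a set of generating
`2`-cells, each with a source and a target in the free monoid on the `1`-cells. -/
structure TwoPolygraph where
  /-- generating `1`-cells -/
  Cell1 : Type u
  /-- generating `2`-cells (rules) -/
  Cell2 : Type v
  src : Cell2 → FreeMonoid Cell1
  tgt : Cell2 → FreeMonoid Cell1

namespace TwoPolygraph

/-- There is a rewriting step `w α w'` from `a` to `b`, with `α` a generating `2`-cell. -/
def Step (P : TwoPolygraph.{u, v}) (a b : FreeMonoid P.Cell1) : Prop :=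
  ∃ (w w' : FreeMonoid P.Cell1) (α : P.Cell2), a = w * P.src α * w' ∧ b = w * P.tgt α * w'

/-- There is no infinite rewriting sequence. -/
def Terminating (P : TwoPolygraph.{u, v}) : Prop :=
  ¬ ∃ f : ℕ → FreeMonoid P.Cell1, ∀ n, P.Step (f n) (f (n + 1))

/-- Any two finite rewriting sequences with the same source can be extended to finite rewriting
sequences with the same target. -/
def Confluent (P : TwoPolygraph.{u, v}) : Prop :=
  ∀ a b c : FreeMonoid P.Cell1,
    Relation.ReflTransGen P.Step a b → Relation.ReflTransGen P.Step a c →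
      ∃ d, Relation.ReflTransGen P.Step b d ∧ Relation.ReflTransGen P.Step c d

/-- Terminating and confluent. -/
def Convergent (P : TwoPolygraph.{u, v}) : Prop :=
  P.Terminating ∧ P.Confluent

/-- The relations given by the generating `2`-cells. -/
def Rel (P : TwoPolygraph.{u, v}) (a b : FreeMonoid P.Cell1) : Prop :=
  ∃ α : P.Cell2, a = P.src α ∧ b = P.tgt α

/-- The monoid presented by a `2`-polygraph: the quotient of the free monoid on the `1`-cells by
the congruence generated by the `2`-cells. -/
abbrev PresentedBy (P : TwoPolygraph.{u, v}) : Type u :=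
  PresentedMonoid P.Rel

end TwoPolygraph

/-! ## Super tableaux over a signed alphabet

The signed alphabet is a totally ordered type `S` with a map `sgn : S → ZMod 2`. -/

namespace SuperPlactic

variable {S : Type u} [LinearOrder S] (sgn : S → ZMod 2)

/-- `a` may stand directly to the left of `b` in a row:
`a ≤ b`, with `a = b` only if the sign is `0`. -/
def RowRel (a b : S) : Prop := a ≤ b ∧ (a = b → sgn a = 0)

/-- `a` may stand directly above `b` in a column:
`a ≤ b`, with `a = b` only if the sign is `1`. -/
def ColRel (a b : S) : Prop := a ≤ b ∧ (a = b → sgn a = 1)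

/-- A super row: a word `x₁ … x_k` with `xᵢ ≤ xᵢ₊₁`, and `xᵢ = xᵢ₊₁` only if the sign is `0`. -/
def IsSuperRow (w : List S) : Prop := w.IsChain (RowRel sgn)

/-- A super column: a word `x₁ … x_k` with `xᵢ₊₁ ≤ xᵢ`, and `xᵢ = xᵢ₊₁` only if the sign is `1`. -/
def IsSuperColumn (w : List S) : Prop := w.IsChain (fun a b => ColRel sgn b a)

/-- The row `r` can stand directly above the row `s`, both being left-justified: `s` is not longer
than `r`, and each entry of `s` satisfies the column condition with the entry of `r` above it. -/
def Above : List S → List S → Prop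
  | _, [] => True
  | [], _ :: _ => False
  | a :: r, b :: s => ColRel sgn a b ∧ Above r s

/-- A super semistandard Young tableau, given by its rows from top to bottom. -/
structure SuperTableau where
  rows : List (List S)
  rows_ne_nil : ∀ r ∈ rows, r ≠ []
  rows_isSuperRow : ∀ r ∈ rows, IsSuperRow sgn r
  rows_above : rows.IsChain (Above sgn)

/-! ### Right (row) insertion -/

open Classical in
/-- Inserting `x` in a row. The letter `x` bumps the first entry `y` of the row with `y > x` if
`x` has sign `0`, and with `y ≥ x` if `x` has sign `1` (that is, with `ColRel sgn x y`, see
`colRel_iff`). If there is none, `x` is put at the right end. The result is the new row, with the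
bumped letter if there is one. -/
noncomputable def insertRow (x : S) : List S → List S × Option S
  | [] => ([x], none)
  | y :: r =>
    if ColRel sgn x y then (x :: r, some y)
    else (y :: (insertRow x r).1, (insertRow x r).2)

/-- Inserting a letter, if there is one, in a list of rows: it is inserted in the top row, and the
bumped letter, if any, is inserted in the rows below. -/
noncomputable def insertRows : Option S → List (List S) → List (List S)
  | none, t => t
  | some x, [] => [[x]]
  | some x, r :: t => (insertRow sgn x r).1 :: insertRows (insertRow sgn x r).2 t

theorem zmod_two_ne {a : ZMod 2} : ¬ a = 1 ↔ a = 0 := by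
  revert a; decide

theorem colRel_iff {x y : S} :
    ColRel sgn x y ↔ (sgn x = 0 ∧ x < y) ∨ (sgn x = 1 ∧ x ≤ y) := by
  unfold ColRel
  have h := zmod_two_ne (a := sgn x)
  have h01 : (0 : ZMod 2) ≠ 1 := by decide
  by_cases hx : sgn x = 1
  · simp [hx]
  · have h0 := h.1 hx
    simp only [h0, h01, true_and, false_and, or_false, imp_false]
    exact lt_iff_le_and_ne.symm

theorem not_colRel {x y : S} : ¬ ColRel sgn x y ↔ RowRel sgn y x := by
  unfold ColRel RowRel
  rcases lt_trichotomy x y with h | h | h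
  · simp [h.le, h.ne, not_le.2 h]
  · subst h; simp [zmod_two_ne]
  · simp [h.le, h.ne', not_le.2 h, h.ne]

theorem ColRel.trans {x y z : S} (h : ColRel sgn x y) (h' : ColRel sgn y z) : ColRel sgn x z := by
  refine ⟨h.1.trans h'.1, ?_⟩
  rintro rfl
  exact h.2 (le_antisymm h.1 h'.1)

theorem RowRel.trans {x y z : S} (h : RowRel sgn x y) (h' : RowRel sgn y z) : RowRel sgn x z := by
  refine ⟨h.1.trans h'.1, ?_⟩
  rintro rfl
  exact h.2 (le_antisymm h.1 h'.1)

theorem ColRel.rowRel_trans {x y z : S} (h : ColRel sgn x y) (h' : RowRel sgn y z) :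
    x ≤ z ∧ (x = z → x = y ∧ sgn x = 1 ∧ sgn y = 0) := by
  refine ⟨h.1.trans h'.1, ?_⟩
  rintro rfl
  have e := le_antisymm h.1 h'.1
  exact ⟨e, h.2 e, h'.2 e.symm⟩

theorem isSuperRow_iff {w : List S} : IsSuperRow sgn w ↔ w.Pairwise (RowRel sgn) :=
  have : IsTrans S (RowRel sgn) := ⟨fun _ _ _ h h' => h.trans sgn h'⟩
  List.isChain_iff_pairwise

theorem insertRow_ne_nil (x : S) (r : List S) : (insertRow sgn x r).1 ≠ [] := by
  cases r with
  | nil => simp [insertRow]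
  | cons y r => simp only [insertRow]; split <;> simp

theorem mem_insertRow {x z : S} {r : List S} (h : z ∈ (insertRow sgn x r).1) : z = x ∨ z ∈ r := by
  induction r with
  | nil => simpa [insertRow] using h
  | cons y r ih =>
    simp only [insertRow] at h
    split at h <;> simp only [List.mem_cons] at h ⊢ <;> tauto

theorem isSuperRow_insertRow (x : S) {r : List S} (hr : IsSuperRow sgn r) :
    IsSuperRow sgn (insertRow sgn x r).1 := by
  rw [isSuperRow_iff] at *
  induction r with
  | nil => simp [insertRow]
  | cons y r ih =>
    rw [List.pairwise_cons] at hr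
    simp only [insertRow]
    split
    · rename_i hxy
      refine List.pairwise_cons.2 ⟨fun z hz => ?_, hr.2⟩
      have h := hxy.rowRel_trans sgn (hr.1 z hz)
      refine ⟨h.1, fun e => ?_⟩
      obtain ⟨h1, h2, h3⟩ := h.2 e
      rw [h1, h3]
    · rename_i hxy
      refine List.pairwise_cons.2 ⟨fun z hz => ?_, ih hr.2⟩
      rcases mem_insertRow sgn hz with rfl | hz
      · exact (not_colRel sgn).1 hxy
      · exact hr.1 z hz

theorem insertRow_bumped {x y : S} {r : List S} (h : (insertRow sgn x r).2 = some y) :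
    ColRel sgn x y ∧ y ∈ r := by
  induction r with
  | nil => simp [insertRow] at h
  | cons z r ih =>
    simp only [insertRow] at h
    split at h
    · simp only [Option.some.injEq] at h
      subst h
      simpa
    · exact ⟨(ih h).1, List.mem_cons_of_mem _ (ih h).2⟩

theorem above_insertRow_left (x : S) {r s : List S} (h : Above sgn r s) :
    Above sgn (insertRow sgn x r).1 s := by
  induction r generalizing s with
  | nil => cases s <;> simp_all [Above]
  | cons a r ih =>
    cases s with
    | nil => simp [Above]
    | cons b s =>
      simp only [insertRow]
      split
      · rename_i hxa
        exact ⟨hxa.trans sgn h.1, h.2⟩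
      · exact ⟨h.1, ih h.2⟩

theorem above_insertRow_insertRow {x y : S} {r s : List S} (hr : IsSuperRow sgn r)
    (h : Above sgn r s) (hy : (insertRow sgn x r).2 = some y) :
    Above sgn (insertRow sgn x r).1 (insertRow sgn y s).1 := by
  rw [isSuperRow_iff] at hr
  induction r generalizing s with
  | nil => simp [insertRow] at hy
  | cons a r ih =>
    rw [List.pairwise_cons] at hr
    by_cases hxa : ColRel sgn x a
    · simp only [insertRow, hxa, if_true, Option.some.injEq] at hy ⊢
      subst hy
      cases s with
      | nil => exact ⟨hxa, by simp [Above]⟩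
      | cons b s =>
        simp only [insertRow, h.1, if_true]
        exact ⟨hxa, h.2⟩
    · simp only [insertRow, hxa, if_false] at hy ⊢
      have hb := insertRow_bumped sgn hy
      have hay : ColRel sgn a y := by
        have h1 := (not_colRel sgn).1 hxa
        refine ⟨h1.1.trans hb.1.1, ?_⟩
        rintro rfl
        exact absurd hb.1 hxa
      cases s with
      | nil => exact ⟨hay, by simp [Above]⟩
      | cons b s =>
        by_cases hyb : ColRel sgn y b
        · simp only [insertRow, hyb, if_true]
          exact ⟨hay, above_insertRow_left sgn x h.2⟩
        · simp only [insertRow, hyb, if_false]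
          exact ⟨h.1, ih hr.2 h.2 hy⟩

theorem insertRows_spec (x : Option S) (t : List (List S)) (h1 : ∀ r ∈ t, r ≠ [])
    (h2 : ∀ r ∈ t, IsSuperRow sgn r) (h3 : t.IsChain (Above sgn)) :
    (∀ r ∈ insertRows sgn x t, r ≠ []) ∧ (∀ r ∈ insertRows sgn x t, IsSuperRow sgn r) ∧
      (insertRows sgn x t).IsChain (Above sgn) := by
  induction t generalizing x with
  | nil => cases x <;> simp [insertRows, IsSuperRow]
  | cons r t ih =>
    cases x with
    | none => exact ⟨h1, h2, h3⟩
    | some x =>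
      simp only [List.forall_mem_cons] at h1 h2
      obtain ⟨i1, i2, i3⟩ := ih (insertRow sgn x r).2 h1.2 h2.2 h3.tail
      refine ⟨?_, ?_, ?_⟩
      · simpa only [insertRows, List.forall_mem_cons] using ⟨insertRow_ne_nil sgn x r, i1⟩
      · simpa only [insertRows, List.forall_mem_cons] using
          ⟨isSuperRow_insertRow sgn x h2.1, i2⟩
      · simp only [insertRows]
        cases hy : (insertRow sgn x r).2 with
        | none =>
          rw [hy] at i3
          cases t with
          | nil => simp [insertRows]
          | cons s t =>
            simp only [insertRows] at i3 ⊢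
            exact List.isChain_cons_cons.2
              ⟨above_insertRow_left sgn x (List.isChain_cons_cons.1 h3).1, i3⟩
        | some y =>
          rw [hy] at i3
          cases t with
          | nil =>
            simp only [insertRows]
            have h := above_insertRow_insertRow sgn (s := []) h2.1 (by simp [Above]) hy
            simpa [insertRow] using h
          | cons s t =>
            simp only [insertRows] at i3 ⊢
            exact List.isChain_cons_cons.2
              ⟨above_insertRow_insertRow sgn h2.1 (List.isChain_cons_cons.1 h3).1 hy, i3⟩

/-- The empty super tableau. -/
def SuperTableau.empty : SuperTableau sgn where
  rows := []
  rows_ne_nil := by simp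
  rows_isSuperRow := by simp
  rows_above := by simp

/-- Right insertion of a letter into a super tableau. -/
noncomputable def SuperTableau.insert (t : SuperTableau sgn) (x : S) : SuperTableau sgn where
  rows := insertRows sgn (some x) t.rows
  rows_ne_nil :=
    (insertRows_spec sgn _ t.rows t.rows_ne_nil t.rows_isSuperRow t.rows_above).1
  rows_isSuperRow :=
    (insertRows_spec sgn _ t.rows t.rows_ne_nil t.rows_isSuperRow t.rows_above).2.1
  rows_above :=
    (insertRows_spec sgn _ t.rows t.rows_ne_nil t.rows_isSuperRow t.rows_above).2.2

/-- The insertion tableau of a word: its letters are inserted from left to right, by right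
insertion, starting from the empty tableau. -/
noncomputable def insertionTableau (w : List S) : SuperTableau sgn :=
  w.foldl (SuperTableau.insert sgn) (SuperTableau.empty sgn)

/-! ### Columns -/

/-- The (nonempty) super columns. -/
def Column : Type u := {w : List S // w ≠ [] ∧ IsSuperColumn sgn w}

/-- The underlying word of a column. -/
def Column.word {sgn : S → ZMod 2} (c : Column sgn) : List S := c.1

/-- The reading, from bottom to top, of the `j`-th column (`j = 0, 1, …`) of a list of rows. -/
def columnReading (t : List (List S)) (j : ℕ) : List S :=
  (t.filterMap (fun r => r[j]?)).reverse

theorem Above.trans {r s t : List S} (h : Above sgn r s) (h' : Above sgn s t) :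
    Above sgn r t := by
  induction t generalizing r s with
  | nil => simp [Above]
  | cons c t ih =>
    cases s with
    | nil => exact h'.elim
    | cons b s =>
      cases r with
      | nil => exact h.elim
      | cons a r => exact ⟨h.1.trans sgn h'.1, ih h.2 h'.2⟩

theorem Above.colRel {r s : List S} (h : Above sgn r s) {j : ℕ} {a b : S} (ha : r[j]? = some a)
    (hb : s[j]? = some b) : ColRel sgn a b := by
  induction j generalizing r s with
  | zero => cases r <;> cases s <;> simp_all [Above]
  | succ j ih =>
    cases r with
    | nil => simp at ha
    | cons c r =>
      cases s with
      | nil => simp at hb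
      | cons d s => exact ih h.2 (by simpa using ha) (by simpa using hb)

theorem isSuperColumn_columnReading (t : SuperTableau sgn) (j : ℕ) :
    IsSuperColumn sgn (columnReading t.rows j) := by
  have : IsTrans (List S) (Above sgn) := ⟨fun _ _ _ h h' => h.trans sgn h'⟩
  have h := List.isChain_iff_pairwise.1 t.rows_above
  refine List.Pairwise.isChain ?_
  rw [columnReading, List.pairwise_reverse, List.pairwise_filterMap]
  refine h.imp ?_
  intro r s hrs a ha b hb
  exact Above.colRel sgn hrs ha hb

/-- The number of columns of a super tableau: the length of its top row. -/
def SuperTableau.numColumns (t : SuperTableau sgn) : ℕ := (t.rows.headD []).length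

theorem columnReading_ne_nil (t : SuperTableau sgn) (j : Fin t.numColumns) :
    columnReading t.rows j ≠ [] := by
  obtain ⟨j, hj⟩ := j
  unfold SuperTableau.numColumns at hj
  cases h : t.rows with
  | nil => simp [h] at hj
  | cons r l =>
    have hj' : j < r.length := by simpa [h] using hj
    simp [columnReading, List.getElem?_eq_getElem hj']

/-- The readings of the columns of a super tableau, from left to right. -/
def SuperTableau.columns (t : SuperTableau sgn) : List (Column sgn) :=
  List.ofFn fun j : Fin t.numColumns =>
    ⟨columnReading t.rows j, columnReading_ne_nil sgn t j, isSuperColumn_columnReading sgn t j⟩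

/-- The topmost juxtaposition of the columns `u` (on the left) and `v` (on the right) is a super
tableau: `v` is not longer than `u`, and each entry of `v` satisfies the row condition with the
entry of `u` at the same distance from the top. As columns are read from bottom to top, the entry
in the `i`-th box from the top is the `i`-th letter of the reversed word. -/
def Juxtaposable (u v : Column sgn) : Prop :=
  v.word.length ≤ u.word.length ∧
    ∀ (i : ℕ) (a b : S), u.word.reverse[i]? = some a → v.word.reverse[i]? = some b →
      RowRel sgn a b

/-! ### The two polygraphs -/

/-- The super Knuth relations. -/
inductive KnuthCell : Type u
  | eta (x y z : S) (hxy : x ≤ y) (hyz : y ≤ z) (exy : x = y → sgn y = 0)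
      (eyz : y = z → sgn y = 1) : KnuthCell
  | epsilon (x y z : S) (hxy : x ≤ y) (hyz : y ≤ z) (exy : x = y → sgn y = 1)
      (eyz : y = z → sgn y = 0) : KnuthCell

/-- The polygraph of super Knuth relations on `S`:
`zxy ⇒ xzy` and `yzx ⇒ yxz` under the respective conditions on `x ≤ y ≤ z`. -/
def knuthPolygraph : TwoPolygraph.{u, u} where
  Cell1 := S
  Cell2 := KnuthCell sgn
  src
    | .eta x y z _ _ _ _ => FreeMonoid.ofList [z, x, y]
    | .epsilon x y z _ _ _ _ => FreeMonoid.ofList [y, z, x]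
  tgt
    | .eta x y z _ _ _ _ => FreeMonoid.ofList [x, z, y]
    | .epsilon x y z _ _ _ _ => FreeMonoid.ofList [y, x, z]

/-- The super plactic monoid. -/
abbrev SuperPlacticMonoid : Type u := (knuthPolygraph sgn).PresentedBy

/-- The class of a word in the super plactic monoid. -/
def placticClass (w : List S) : SuperPlacticMonoid sgn :=
  PresentedMonoid.mk (knuthPolygraph sgn).Rel (FreeMonoid.ofList w)

/-- The super column polygraph. Its `1`-cells are the super columns, and it has one `2`-cell
`c_u c_v ⇒ c_w c_{w'}` for each pair of columns `u`, `v` whose topmost juxtaposition is not a super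
tableau. The target is the product of the generators of the columns, from left to right, of the
insertion tableau of `uv` (one or two columns). -/
noncomputable def columnPolygraph : TwoPolygraph.{u, u} where
  Cell1 := Column sgn
  Cell2 := {p : Column sgn × Column sgn // ¬ Juxtaposable sgn p.1 p.2}
  src p := FreeMonoid.ofList [p.1.1, p.1.2]
  tgt p := FreeMonoid.ofList (insertionTableau sgn (p.1.1.word ++ p.1.2.word)).columns

end SuperPlactic

namespace SuperPlactic

variable {S : Type u} [LinearOrder S] {sgn : S → ZMod 2}

/-! ### Mixed transitivity of the row and column relations -/

/-! A product of generators is irreducible exactly when consecutive columns can be juxtaposed, that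
is, when its factors are the columns of a super tableau. Everything follows once each plactic class
is known to contain the reading of exactly one such product, and the rules are known to terminate.

Uniqueness: insertion is constant on plactic classes (`insertionTableau_eq_of_placticClass_eq`), and
the column reading of a tableau inserts back to that tableau
(`columns_insertionTableau_columnsWord`). The first fact is proved row by row: the two sides of a
Knuth relation turn a row into the same row and bump words that are equal or again Knuth related.
Existence: a word is equivalent to the row reading of its insertion tableau, and hence to the column
reading, because both readings insert to the same tableau. Rules therefore preserve the class of the
reading, and two products with equivalent readings reduce to the same normal form
(`exists_common_reduct`). This gives both confluence and injectivity of the map to the super plactic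
monoid.

Termination: a rule preserves the number of letters and either merges two columns or makes the left
one strictly longer (`length_lt_length_first_column`), so letters move to the left and
`positionWeight` drops. The lengthening rests on `beside_of_length_insertWord_le`: a column inserted
in a column without creating a new row must already fit beside it. -/

theorem RowRel.colRel_trans {x y z : S} (h : RowRel sgn x y) (h' : ColRel sgn y z) :
    ColRel sgn x z := by
  refine ⟨h.1.trans h'.1, ?_⟩
  rintro rfl
  have e := le_antisymm h.1 h'.1
  subst e
  exact h'.2 rfl

/-- In a mixed composition `x = z` would force `x = y = z`, with sign both `0` and `1`. The
composite is thus strict and satisfies both relations, which gives all four mixed laws. -/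
theorem ColRel.colRel_of_rowRel {x y z : S} (h : ColRel sgn x y) (h' : RowRel sgn y z) :
    ColRel sgn x z := by
  refine ⟨h.1.trans h'.1, ?_⟩
  rintro rfl
  exact h.2 (le_antisymm h.1 h'.1)

theorem ColRel.rowRel_of_rowRel {x y z : S} (h : ColRel sgn x y) (h' : RowRel sgn y z) :
    RowRel sgn x z := by
  refine ⟨h.1.trans h'.1, ?_⟩
  rintro rfl
  have e := le_antisymm h.1 h'.1
  subst e
  exact h'.2 rfl

theorem RowRel.rowRel_of_colRel {x y z : S} (h : RowRel sgn x y) (h' : ColRel sgn y z) :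
    RowRel sgn x z := by
  refine ⟨h.1.trans h'.1, ?_⟩
  rintro rfl
  exact h.2 (le_antisymm h.1 h'.1)

theorem RowRel.not_colRel {x y : S} (h : RowRel sgn x y) : ¬ ColRel sgn y x :=
  (SuperPlactic.not_colRel sgn).2 h

theorem rowRel_of_not_colRel {x y : S} (h : ¬ ColRel sgn x y) : RowRel sgn y x :=
  (SuperPlactic.not_colRel sgn).1 h

/-! ### Inserting words in rows -/

theorem insertRow_cons_of_colRel {x a : S} {r : List S} (h : ColRel sgn x a) :
    insertRow sgn x (a :: r) = (x :: r, some a) := by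
  simp [insertRow, h]

theorem insertRow_cons_of_rowRel {x a : S} {r : List S} (h : RowRel sgn a x) :
    insertRow sgn x (a :: r) = (a :: (insertRow sgn x r).1, (insertRow sgn x r).2) := by
  simp [insertRow, h.not_colRel]

theorem insertRow_nil (x : S) : insertRow sgn x [] = ([x], none) := rfl

variable (sgn) in
/-- Insertion of a word in a row, with the word of the bumped letters. -/
noncomputable def insertRowWord : List S → List S → List S × List S
  | [], r => (r, [])
  | x :: p, r =>
    ((insertRowWord p (insertRow sgn x r).1).1,
      (insertRow sgn x r).2.toList ++ (insertRowWord p (insertRow sgn x r).1).2)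

variable (sgn) in
/-- Insertion of a word in a list of rows. -/
noncomputable def insertWord (p : List S) (t : List (List S)) : List (List S) :=
  p.foldl (fun t x => insertRows sgn (some x) t) t

theorem insertWord_append (p q : List S) (t : List (List S)) :
    insertWord sgn (p ++ q) t = insertWord sgn q (insertWord sgn p t) := by
  simp [insertWord]

theorem insertRows_eq_insertWord (o : Option S) (t : List (List S)) :
    insertRows sgn o t = insertWord sgn o.toList t := by
  cases o <;> simp [insertWord, insertRows]

/-- Letters need not descend one at a time: the whole word can pass through the top row before the
bumped word enters the rows below. This permits induction on rows. -/
theorem insertWord_cons_rows (p r : List S) (t : List (List S)) :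
    insertWord sgn p (r :: t) =
      (insertRowWord sgn p r).1 :: insertWord sgn (insertRowWord sgn p r).2 t := by
  induction p generalizing r t with
  | nil => rfl
  | cons x p ih =>
    change insertWord sgn p (insertRows sgn (some x) (r :: t)) = _
    rw [insertRows, ih, insertRowWord, insertWord_append, insertRows_eq_insertWord]

theorem insertWord_cons_nil (x : S) (p : List S) :
    insertWord sgn (x :: p) [] =
      (insertRowWord sgn (x :: p) []).1 :: insertWord sgn (insertRowWord sgn (x :: p) []).2 [] := by
  change insertWord sgn p [[x]] = _
  rw [insertWord_cons_rows]
  simp [insertRowWord, insertRow_nil]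

theorem insertRowWord_append (p q r : List S) :
    insertRowWord sgn (p ++ q) r =
      ((insertRowWord sgn q (insertRowWord sgn p r).1).1,
        (insertRowWord sgn p r).2 ++ (insertRowWord sgn q (insertRowWord sgn p r).1).2) := by
  induction p generalizing r with
  | nil => rfl
  | cons x p ih => simp [insertRowWord, ih]

theorem insertRowWord_cons_of_rowRel {p r : List S} {a : S} (h : ∀ x ∈ p, RowRel sgn a x) :
    insertRowWord sgn p (a :: r) =
      (a :: (insertRowWord sgn p r).1, (insertRowWord sgn p r).2) := by
  induction p generalizing r with
  | nil => rfl
  | cons x p ih =>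
    rw [List.forall_mem_cons] at h
    simp [insertRowWord, insertRow_cons_of_rowRel h.1, ih h.2]

theorem isSuperRow_cons {a : S} {r : List S} :
    IsSuperRow sgn (a :: r) ↔ (∀ b ∈ r, RowRel sgn a b) ∧ IsSuperRow sgn r := by
  rw [isSuperRow_iff, isSuperRow_iff, List.pairwise_cons]

/-! ### Two successive insertions in a row -/

/-- Inserting `z`, then `y` with `ColRel y z`: the second bumped letter exists, and it stands in
column order with the first one. -/
theorem exists_bumped_of_colRel {y z : S} {r : List S} (hr : IsSuperRow sgn r)
    (hyz : ColRel sgn y z) :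
    ∃ c, (insertRow sgn y (insertRow sgn z r).1).2 = some c ∧
      (c = z ∨ c ∈ r) ∧ ∀ b, (insertRow sgn z r).2 = some b → ColRel sgn c b := by
  induction r with
  | nil => exact ⟨z, by simp [insertRow, hyz]⟩
  | cons a r ih =>
    rw [isSuperRow_cons] at hr
    by_cases hza : ColRel sgn z a
    · exact ⟨z, by simp [insertRow_cons_of_colRel hza, insertRow_cons_of_colRel hyz, hza]⟩
    · have haz := rowRel_of_not_colRel hza
      by_cases hya : ColRel sgn y a
      · refine ⟨a, by simp [insertRow_cons_of_rowRel haz, insertRow_cons_of_colRel hya], by simp,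
          fun b hb => ?_⟩
        rw [insertRow_cons_of_rowRel haz] at hb
        exact haz.colRel_trans (insertRow_bumped sgn hb).1
      · have hay := rowRel_of_not_colRel hya
        obtain ⟨c, h1, h2, h3⟩ := ih hr.2
        refine ⟨c, by simpa [insertRow_cons_of_rowRel haz, insertRow_cons_of_rowRel hay] using h1,
          by simp only [List.mem_cons]; tauto, fun b hb => h3 b ?_⟩
        simpa [insertRow_cons_of_rowRel haz] using hb

/-- Inserting `y`, then `z` with `RowRel y z`: if the second insertion bumps a letter then so does
the first, and the bumped letters stand in row order. -/
theorem exists_bumped_of_rowRel {y z c : S} {r : List S} (hr : IsSuperRow sgn r)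
    (hyz : RowRel sgn y z) (hc : (insertRow sgn z (insertRow sgn y r).1).2 = some c) :
    ∃ b, (insertRow sgn y r).2 = some b ∧ RowRel sgn b c := by
  induction r with
  | nil => simp [insertRow, hyz.not_colRel] at hc
  | cons a r ih =>
    rw [isSuperRow_cons] at hr
    by_cases hya : ColRel sgn y a
    · refine ⟨a, by rw [insertRow_cons_of_colRel hya], ?_⟩
      rw [insertRow_cons_of_colRel hya, insertRow_cons_of_rowRel hyz] at hc
      exact hr.1 c (insertRow_bumped sgn hc).2
    · have hay := rowRel_of_not_colRel hya
      have haz := hay.trans sgn hyz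
      rw [insertRow_cons_of_rowRel hay] at hc ⊢
      rw [insertRow_cons_of_rowRel haz] at hc
      exact ih hr.2 hc

/-! ### Knuth relations and insertion -/

variable (sgn) in
/-- The super Knuth relations on words. -/
def KnuthRel (p q : List S) : Prop :=
  (∃ x y z, RowRel sgn x y ∧ ColRel sgn y z ∧ p = [z, x, y] ∧ q = [x, z, y]) ∨
    ∃ x y z, ColRel sgn x y ∧ RowRel sgn y z ∧ p = [y, z, x] ∧ q = [y, x, z]

theorem KnuthRel.eta {x y z : S} (h : RowRel sgn x y) (h' : ColRel sgn y z) :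
    KnuthRel sgn [z, x, y] [x, z, y] := Or.inl ⟨x, y, z, h, h', rfl, rfl⟩

theorem KnuthRel.epsilon {x y z : S} (h : ColRel sgn x y) (h' : RowRel sgn y z) :
    KnuthRel sgn [y, z, x] [y, x, z] := Or.inr ⟨x, y, z, h, h', rfl, rfl⟩

/-- Compare with the head `a` of the row. If `x` does not bump `a`, neither do `y` and `z`, and the
tail decides. If `x` bumps `a` but `z` does not, the bumped words are equal or form an eta relation.
If both can bump `a`, the words are `a z c` and `a c z` (or both `a z`), an epsilon relation in the
opposite direction; hence the third alternative. -/
theorem insertRowWord_eta {x y z : S} {r : List S} (hxy : RowRel sgn x y) (hyz : ColRel sgn y z)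
    (hr : IsSuperRow sgn r) :
    (insertRowWord sgn [z, x, y] r).1 = (insertRowWord sgn [x, z, y] r).1 ∧
      ((insertRowWord sgn [z, x, y] r).2 = (insertRowWord sgn [x, z, y] r).2 ∨
        KnuthRel sgn (insertRowWord sgn [z, x, y] r).2 (insertRowWord sgn [x, z, y] r).2 ∨
        KnuthRel sgn (insertRowWord sgn [x, z, y] r).2 (insertRowWord sgn [z, x, y] r).2) := by
  have hxz := hxy.colRel_trans hyz
  have hxz' := hxy.rowRel_of_colRel hyz
  induction r with
  | nil =>
    simp [insertRowWord, insertRow_nil, insertRow_cons_of_colRel hxz,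
      insertRow_cons_of_rowRel hxy, insertRow_cons_of_rowRel hxz', insertRow_cons_of_colRel hyz]
  | cons a r ih =>
    rw [isSuperRow_cons] at hr
    by_cases hxa : ColRel sgn x a
    · by_cases hza : ColRel sgn z a
      · simp only [insertRowWord, insertRow_cons_of_colRel hxa, insertRow_cons_of_colRel hza,
          insertRow_cons_of_colRel hxz, insertRow_cons_of_rowRel hxy,
          insertRow_cons_of_rowRel hxz']
        cases r with
        | nil => simp [insertRow_nil, insertRow_cons_of_colRel hyz]
        | cons c r =>
          have hac := hr.1 c (by simp)
          have hzc := hza.colRel_of_rowRel hac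
          have hyc := hyz.trans sgn hzc
          simp only [insertRow_cons_of_colRel hzc, insertRow_cons_of_colRel hyc,
            insertRow_cons_of_colRel hyz, true_and]
          exact Or.inr (Or.inr (KnuthRel.epsilon hza hac))
      · have haz := rowRel_of_not_colRel hza
        obtain ⟨c, h1, h2, h3⟩ := exists_bumped_of_colRel hr.2 hyz
        simp only [insertRowWord, insertRow_cons_of_colRel hxa, insertRow_cons_of_rowRel haz,
          insertRow_cons_of_rowRel hxy, insertRow_cons_of_rowRel hxz', h1, true_and]
        cases hb : (insertRow sgn z r).2 with
        | none => simp
        | some b =>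
          refine Or.inr (Or.inl (KnuthRel.eta ?_ (h3 b hb)))
          rcases h2 with rfl | h2
          · exact haz
          · exact hr.1 c h2
    · have hax := rowRel_of_not_colRel hxa
      have hay := hax.trans sgn hxy
      have haz := hay.rowRel_of_colRel hyz
      rw [insertRowWord_cons_of_rowRel (by simp [hax, hay, haz]),
        insertRowWord_cons_of_rowRel (by simp [hax, hay, haz])]
      simpa using ih hr.2

/-- Here an epsilon relation only yields equality or an epsilon relation in the same direction. When
`y` passes the head and `x` bumps it, `exists_bumped_of_rowRel` supplies the letter bumped by `y`.
-/
theorem insertRowWord_epsilon {x y z : S} {r : List S} (hxy : ColRel sgn x y)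
    (hyz : RowRel sgn y z) (hr : IsSuperRow sgn r) :
    (insertRowWord sgn [y, z, x] r).1 = (insertRowWord sgn [y, x, z] r).1 ∧
      ((insertRowWord sgn [y, z, x] r).2 = (insertRowWord sgn [y, x, z] r).2 ∨
        KnuthRel sgn (insertRowWord sgn [y, z, x] r).2 (insertRowWord sgn [y, x, z] r).2) := by
  have hxz := hxy.rowRel_of_rowRel hyz
  induction r with
  | nil =>
    simp [insertRowWord, insertRow_nil, insertRow_cons_of_colRel hxy,
      insertRow_cons_of_rowRel hyz, insertRow_cons_of_rowRel hxz]
  | cons a r ih =>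
    rw [isSuperRow_cons] at hr
    by_cases hya : ColRel sgn y a
    · simp only [insertRowWord, insertRow_cons_of_colRel hya, insertRow_cons_of_colRel hxy,
          insertRow_cons_of_rowRel hyz, insertRow_cons_of_rowRel hxz, true_and]
      cases hb : (insertRow sgn z r).2 with
      | none => simp
      | some b => exact Or.inr (KnuthRel.epsilon hya (hr.1 b (insertRow_bumped sgn hb).2))
    · have hay := rowRel_of_not_colRel hya
      have haz := hay.trans sgn hyz
      by_cases hxa : ColRel sgn x a
      · simp only [insertRowWord, insertRow_cons_of_colRel hxa, insertRow_cons_of_rowRel hay,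
          insertRow_cons_of_rowRel haz, insertRow_cons_of_rowRel hxz, true_and]
        cases hc : (insertRow sgn z (insertRow sgn y r).1).2 with
        | none => simp
        | some c =>
          obtain ⟨b, hb, hbc⟩ := exists_bumped_of_rowRel hr.2 hyz hc
          rw [hb]
          exact Or.inr (KnuthRel.epsilon (hay.colRel_trans (insertRow_bumped sgn hb).1) hbc)
      · have hax := rowRel_of_not_colRel hxa
        rw [insertRowWord_cons_of_rowRel (by simp [hax, hay, haz]),
          insertRowWord_cons_of_rowRel (by simp [hax, hay, haz])]
        simpa using ih hr.2

theorem KnuthRel.insertWord_eq {p q : List S} (h : KnuthRel sgn p q) {t : List (List S)}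
    (ht : ∀ r ∈ t, IsSuperRow sgn r) : insertWord sgn p t = insertWord sgn q t := by
  induction t generalizing p q with
  | nil =>
    rcases h with ⟨x, y, z, h1, h2, rfl, rfl⟩ | ⟨x, y, z, h1, h2, rfl, rfl⟩
    · simp [insertWord, insertRows, insertRow_nil, insertRow_cons_of_rowRel h1,
        insertRow_cons_of_colRel (h1.colRel_trans h2), insertRow_cons_of_colRel h2,
        insertRow_cons_of_rowRel (h1.rowRel_of_colRel h2)]
    · simp [insertWord, insertRows, insertRow_nil, insertRow_cons_of_colRel h1,
        insertRow_cons_of_rowRel h2, insertRow_cons_of_rowRel (h1.rowRel_of_rowRel h2)]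
  | cons r t ih =>
    rw [List.forall_mem_cons] at ht
    rw [insertWord_cons_rows, insertWord_cons_rows]
    rcases h with ⟨x, y, z, h1, h2, rfl, rfl⟩ | ⟨x, y, z, h1, h2, rfl, rfl⟩
    · obtain ⟨e, h | h | h⟩ := insertRowWord_eta h1 h2 ht.1
      · rw [e, h]
      · rw [e, ih h ht.2]
      · rw [e, ih h ht.2]
    · obtain ⟨e, h | h⟩ := insertRowWord_epsilon h1 h2 ht.1
      · rw [e, h]
      · rw [e, ih h ht.2]

theorem foldl_insert_rows (w : List S) (t : SuperTableau sgn) :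
    (w.foldl (SuperTableau.insert sgn) t).rows = insertWord sgn w t.rows := by
  induction w generalizing t with
  | nil => rfl
  | cons x w ih => exact ih _

theorem insertionTableau_rows (w : List S) :
    (insertionTableau sgn w).rows = insertWord sgn w [] :=
  foldl_insert_rows w _

theorem SuperTableau.ext_rows {t t' : SuperTableau sgn} (h : t.rows = t'.rows) : t = t' := by
  cases t; cases t'; cases h; rfl

theorem knuthPolygraph_rel_iff {a b : FreeMonoid S} :
    (knuthPolygraph sgn).Rel a b ↔ KnuthRel sgn a.toList b.toList := by
  constructor
  · rintro ⟨α, rfl, rfl⟩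
    rcases α with ⟨x, y, z, h1, h2, h3, h4⟩ | ⟨x, y, z, h1, h2, h3, h4⟩
    · exact KnuthRel.eta ⟨h1, fun e => e ▸ h3 e⟩ ⟨h2, h4⟩
    · exact KnuthRel.epsilon ⟨h1, fun e => e ▸ h3 e⟩ ⟨h2, h4⟩
  · rintro (⟨x, y, z, h1, h2, ha, hb⟩ | ⟨x, y, z, h1, h2, ha, hb⟩)
    · exact ⟨.eta x y z h1.1 h2.1 (fun e => e ▸ h1.2 e) h2.2, ha, hb⟩
    · exact ⟨.epsilon x y z h1.1 h2.1 (fun e => e ▸ h1.2 e) h2.2, ha, hb⟩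

/-! ### The plactic class of a word and its invariants -/

theorem placticClass_append (a b : List S) :
    placticClass sgn (a ++ b) = placticClass sgn a * placticClass sgn b := rfl

theorem KnuthRel.placticClass_eq {p q : List S} (h : KnuthRel sgn p q) :
    placticClass sgn p = placticClass sgn q :=
  PresentedMonoid.mk_eq_mk_of_rel (knuthPolygraph_rel_iff.2 h)

variable (sgn) in
/-- The right action of the free monoid on super tableaux by insertion. -/
noncomputable def insertionActionFree : FreeMonoid S →* (Function.End (SuperTableau sgn))ᵐᵒᵖ :=
  FreeMonoid.lift fun x => MulOpposite.op fun t => t.insert sgn x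

theorem insertionActionFree_apply (w : List S) (t : SuperTableau sgn) :
    (insertionActionFree sgn (FreeMonoid.ofList w)).unop t =
      w.foldl (SuperTableau.insert sgn) t := by
  induction w generalizing t with
  | nil => rfl
  | cons x w ih =>
    rw [FreeMonoid.ofList_cons, map_mul, List.foldl_cons, ← ih]
    rfl

/-- The insertion action factors through the super plactic monoid, and the insertion tableau is the
image of the empty tableau. -/
theorem insertionTableau_eq_of_placticClass_eq {w w' : List S}
    (h : placticClass sgn w = placticClass sgn w') :
    insertionTableau sgn w = insertionTableau sgn w' := by
  have H : ∀ a b : FreeMonoid S, (knuthPolygraph sgn).Rel a b →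
      insertionActionFree sgn a = insertionActionFree sgn b := by
    intro a b hab
    apply MulOpposite.unop_injective
    funext t
    rw [← FreeMonoid.ofList_toList a, ← FreeMonoid.ofList_toList b, insertionActionFree_apply,
      insertionActionFree_apply]
    apply SuperTableau.ext_rows
    rw [foldl_insert_rows, foldl_insert_rows]
    exact (knuthPolygraph_rel_iff.1 hab).insertWord_eq t.rows_isSuperRow
  have h' := congrArg (fun m => (PresentedMonoid.lift _ H m).unop (SuperTableau.empty sgn)) h
  rw [insertionTableau, insertionTableau, ← insertionActionFree_apply, ← insertionActionFree_apply]
  exact h'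

theorem length_eq_of_placticClass_eq {w w' : List S}
    (h : placticClass sgn w = placticClass sgn w') : w.length = w'.length := by
  have H : ∀ a b : FreeMonoid S, (knuthPolygraph sgn).Rel a b →
      FreeMonoid.lift (fun _ : S => Multiplicative.ofAdd 1) a =
        FreeMonoid.lift (fun _ : S => Multiplicative.ofAdd 1) b := by
    intro a b hab
    rcases knuthPolygraph_rel_iff.1 hab with ⟨x, y, z, -, -, ha, hb⟩ | ⟨x, y, z, -, -, ha, hb⟩ <;>
    · rw [← FreeMonoid.ofList_toList a, ← FreeMonoid.ofList_toList b, ha, hb]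
      rfl
  have key : ∀ w : List S, FreeMonoid.lift (fun _ : S => Multiplicative.ofAdd 1)
      (FreeMonoid.ofList w) = Multiplicative.ofAdd w.length := by
    intro w
    simp [FreeMonoid.lift_apply, ← ofAdd_nsmul]
  have h' := congrArg (fun m => PresentedMonoid.lift _ H m) h
  have h2 : FreeMonoid.lift (fun _ : S => Multiplicative.ofAdd 1) (FreeMonoid.ofList w) =
    FreeMonoid.lift (fun _ : S => Multiplicative.ofAdd 1) (FreeMonoid.ofList w') := h'
  rw [key, key] at h2
  exact Multiplicative.ofAdd.injective h2

/-! ### A word is equivalent to the row reading of its insertion tableau -/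

/-- Epsilon relations `a c x = a x c` carry `x` leftwards through the row until it stands just after
`a`. -/
theorem placticClass_cons_append_singleton {x a : S} {r : List S} (hxa : ColRel sgn x a)
    (hr : IsSuperRow sgn (a :: r)) :
    placticClass sgn (a :: r ++ [x]) = placticClass sgn (a :: x :: r) := by
  induction r generalizing a with
  | nil => rfl
  | cons c r ih =>
    rw [isSuperRow_cons] at hr
    have hac := hr.1 c (by simp)
    have h1 := ih (hxa.colRel_of_rowRel hac) hr.2
    have h2 := (KnuthRel.epsilon hxa hac).placticClass_eq
    calc placticClass sgn (a :: c :: r ++ [x])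
        = placticClass sgn [a] * placticClass sgn (c :: r ++ [x]) := rfl
      _ = placticClass sgn [a, c, x] * placticClass sgn r := by rw [h1]; rfl
      _ = _ := by rw [h2]; rfl

theorem insertRow_bumped_head {x b : S} {r : List S} (h : (insertRow sgn x r).2 = some b) :
    ∃ c s, (insertRow sgn x r).1 = c :: s ∧ ColRel sgn c b ∧ (c = x ∨ c ∈ r) := by
  have hb := (insertRow_bumped sgn h).1
  cases r with
  | nil => simp [insertRow_nil] at h
  | cons a r =>
    by_cases hxa : ColRel sgn x a
    · exact ⟨x, r, by rw [insertRow_cons_of_colRel hxa], hb, Or.inl rfl⟩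
    · have hax := rowRel_of_not_colRel hxa
      exact ⟨a, (insertRow sgn x r).1, by rw [insertRow_cons_of_rowRel hax],
        hax.colRel_trans hb, by simp⟩

/-- After epsilon relations have moved `x` to its place, eta relations `a b c = b a c` carry the
bumped letter `b` to the front. The letter `c` that they need on the right is the head given by
`insertRow_bumped_head`. -/
theorem placticClass_insertRow (x : S) {r : List S} (hr : IsSuperRow sgn r) :
    placticClass sgn (r ++ [x]) =
      placticClass sgn ((insertRow sgn x r).2.toList ++ (insertRow sgn x r).1) := by
  induction r with
  | nil => rfl
  | cons a r ih =>
    by_cases hxa : ColRel sgn x a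
    · rw [insertRow_cons_of_colRel hxa, placticClass_cons_append_singleton hxa hr]
      rfl
    · have hax := rowRel_of_not_colRel hxa
      rw [isSuperRow_cons] at hr
      rw [insertRow_cons_of_rowRel hax]
      have h1 : placticClass sgn (a :: r ++ [x]) = placticClass sgn [a] *
        placticClass sgn ((insertRow sgn x r).2.toList ++ (insertRow sgn x r).1) := by
        rw [← ih hr.2]; rfl
      rw [h1]
      cases hb : (insertRow sgn x r).2 with
      | none => rfl
      | some b =>
        obtain ⟨c, s, hc, hcb, hcr⟩ := insertRow_bumped_head hb
        have hac : RowRel sgn a c := by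
          rcases hcr with rfl | hcr
          · exact hax
          · exact hr.1 c hcr
        rw [hc]
        change placticClass sgn [a, b, c] * placticClass sgn s =
          placticClass sgn [b, a, c] * placticClass sgn s
        rw [(KnuthRel.eta hac hcb).placticClass_eq]

/-- The reading of a list of rows from bottom to top, each row being read from left to right. -/
def rowReading (t : List (List S)) : List S := t.reverse.flatten

theorem rowReading_cons {S : Type u} (r : List S) (t : List (List S)) :
    rowReading (r :: t) = rowReading t ++ r := by
  simp [rowReading]

/-- Reading from bottom to top puts the letter bumped from a row right after the reading of the rows
below, where the induction hypothesis absorbs it. -/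
theorem placticClass_insertRows (o : Option S) {t : List (List S)}
    (ht : ∀ r ∈ t, IsSuperRow sgn r) :
    placticClass sgn (rowReading (insertRows sgn o t)) =
      placticClass sgn (rowReading t ++ o.toList) := by
  induction t generalizing o with
  | nil => cases o <;> rfl
  | cons r t ih =>
    rw [List.forall_mem_cons] at ht
    cases o with
    | none => simp [insertRows]
    | some x =>
      rw [insertRows, rowReading_cons, rowReading_cons, placticClass_append, ih _ ht.2,
        ← placticClass_append, List.append_assoc, List.append_assoc, placticClass_append,
        ← placticClass_insertRow x ht.1, ← placticClass_append]
      rfl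

theorem placticClass_rowReading_insertionTableau (w : List S) :
    placticClass sgn (rowReading (insertionTableau sgn w).rows) = placticClass sgn w := by
  induction w using List.reverseRecOn with
  | nil => rfl
  | append_singleton w x ih =>
    have h : insertionTableau sgn (w ++ [x]) = (insertionTableau sgn w).insert sgn x := by
      simp [insertionTableau]
    rw [h]
    change placticClass sgn (rowReading (insertRows sgn (some x) _)) = _
    rw [placticClass_insertRows _ (insertionTableau sgn w).rows_isSuperRow, placticClass_append,
      ih, placticClass_append]
    rfl

/-! ### Juxtaposition of columns, read from top to bottom -/

variable (sgn) in
/-- The column `s` may be placed to the right of the column `r`, both read from top to bottom. -/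
def Beside (r s : List S) : Prop :=
  s.length ≤ r.length ∧
    ∀ (i : ℕ) (a b : S), r[i]? = some a → s[i]? = some b → RowRel sgn a b

theorem Beside.trans {r s t : List S} (h : Beside sgn r s) (h' : Beside sgn s t) :
    Beside sgn r t := by
  refine ⟨h'.1.trans h.1, fun i a c ha hc => ?_⟩
  obtain ⟨hi, -⟩ := List.getElem?_eq_some_iff.1 hc
  have hb := List.getElem?_eq_getElem (hi.trans_le h'.1)
  exact (h.2 i a _ ha hb).trans sgn (h'.2 i _ c hb hc)

theorem beside_nil (r : List S) : Beside sgn r [] := by simp [Beside]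

theorem beside_cons_cons {a b : S} {r s : List S} :
    Beside sgn (a :: r) (b :: s) ↔ RowRel sgn a b ∧ Beside sgn r s := by
  constructor
  · rintro ⟨h1, h2⟩
    exact ⟨h2 0 a b rfl rfl, by simpa using h1, fun i => by simpa using h2 (i + 1)⟩
  · rintro ⟨h0, h1, h2⟩
    refine ⟨by simpa using h1, fun i => ?_⟩
    cases i with
    | zero => simpa using h0
    | succ i => simpa using h2 i

theorem juxtaposable_iff_beside {u v : Column sgn} :
    Juxtaposable sgn u v ↔ Beside sgn u.word.reverse v.word.reverse := by
  simp [Juxtaposable, Beside]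

/-! ### Adding a column to a list of rows -/

/-- Adding a column, read from top to bottom, at the right ends of the rows. -/
def addColumn : List (List S) → List S → List (List S)
  | t, [] => t
  | [], d :: ds => [d] :: addColumn [] ds
  | r :: t, d :: ds => (r ++ [d]) :: addColumn t ds

/-- Adding a column, read from top to bottom, at the left of the rows. -/
def consColumn : List S → List (List S) → List (List S)
  | [], t => t
  | a :: c, [] => [a] :: consColumn c []
  | a :: c, r :: t => (a :: r) :: consColumn c t

variable (sgn) in
/-- The entries of each row stand in row order with the entry of the column at that height. -/
def RowsBeside : List (List S) → List S → Prop
  | r :: t, d :: ds => (∀ a ∈ r, RowRel sgn a d) ∧ RowsBeside t ds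
  | _, _ => True

/-- A column inserted from its bottom letter first occupies positions above its final ones. Each
letter is still in row order there, since it follows in column order the letter that ends in that
row. -/
theorem RowsBeside.tail {t : List (List S)} {d : S} {ds : List S}
    (h : RowsBeside sgn t (d :: ds)) (hc : (d :: ds).IsChain (ColRel sgn)) :
    RowsBeside sgn t ds := by
  induction ds generalizing t d with
  | nil => cases t <;> trivial
  | cons e ds ih =>
    cases t with
    | nil => trivial
    | cons r t =>
      rw [List.isChain_cons_cons] at hc
      exact ⟨fun a ha => (h.1 a ha).rowRel_of_colRel hc.1, ih h.2 hc.2⟩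

theorem insertRow_append_of_rowRel {x : S} {r s : List S} (h : ∀ a ∈ r, RowRel sgn a x) :
    insertRow sgn x (r ++ s) = (r ++ (insertRow sgn x s).1, (insertRow sgn x s).2) := by
  induction r with
  | nil => rfl
  | cons a r ih =>
    rw [List.forall_mem_cons] at h
    simp [insertRow_cons_of_rowRel h.1, ih h.2]

/-- The letter `d` passes the old entries of the top row and bumps the head of `ds`, which does the
same one row below: the new column slides down by one box. -/
theorem insertRows_addColumn {t : List (List S)} {d : S} {ds : List S}
    (h : RowsBeside sgn t (d :: ds)) (hc : (d :: ds).IsChain (ColRel sgn)) :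
    insertRows sgn (some d) (addColumn t ds) = addColumn t (d :: ds) := by
  induction ds generalizing t d with
  | nil =>
    cases t with
    | nil => rfl
    | cons r t =>
      have := insertRow_append_of_rowRel (s := []) h.1
      rw [List.append_nil] at this
      simp [addColumn, insertRows, this, insertRow_nil]
  | cons e ds ih =>
    rw [List.isChain_cons_cons] at hc
    cases t with
    | nil =>
      simp only [addColumn, insertRows, insertRow_cons_of_colRel hc.1]
      have := ih (t := []) (d := e) trivial hc.2
      rw [this, addColumn]
    | cons r t =>
      simp only [addColumn, insertRows, insertRow_append_of_rowRel h.1,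
        insertRow_cons_of_colRel hc.1]
      rw [ih h.2 hc.2]

theorem insertWord_reverse_eq_addColumn {t : List (List S)} {ds : List S}
    (h : RowsBeside sgn t ds) (hc : ds.IsChain (ColRel sgn)) :
    insertWord sgn ds.reverse t = addColumn t ds := by
  induction ds with
  | nil => cases t <;> rfl
  | cons d ds ih =>
    rw [List.reverse_cons, insertWord_append, ih (h.tail hc) hc.tail, ← insertRows_addColumn h hc]
    rfl

theorem addColumn_nil {S : Type u} (t : List (List S)) : addColumn t [] = t := by cases t <;> rfl

theorem consColumn_addColumn {S : Type u} {c d : List S} (t : List (List S)) (h : d.length ≤ c.length) :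
    consColumn c (addColumn t d) = addColumn (consColumn c t) d := by
  induction c generalizing d t with
  | nil =>
    obtain rfl : d = [] := by simpa using h
    simp [addColumn_nil]
  | cons a c ih =>
    cases d with
    | nil => simp [addColumn_nil]
    | cons e d =>
      have h' : d.length ≤ c.length := by simpa using h
      cases t with
      | nil => simp [addColumn, consColumn, ih [] h']
      | cons r t => simp [addColumn, consColumn, ih t h']

/-- The rows of the juxtaposition of a list of columns, read from top to bottom. -/
def rowsOfColumns (cs : List (List S)) : List (List S) := cs.foldr consColumn []

theorem rowsOfColumns_concat {S : Type u} {cs : List (List S)} {d : List S}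
    (h : ∀ c ∈ cs, d.length ≤ c.length) :
    rowsOfColumns (cs ++ [d]) = addColumn (rowsOfColumns cs) d := by
  induction cs with
  | nil =>
    change consColumn d [] = addColumn [] d
    induction d with
    | nil => rfl
    | cons a d ih => simpa [consColumn, addColumn] using ih (by simp)
  | cons c cs ih =>
    rw [List.forall_mem_cons] at h
    change consColumn c (rowsOfColumns (cs ++ [d])) = addColumn (consColumn c (rowsOfColumns cs)) d
    rw [ih h.2, consColumn_addColumn _ h.1]

theorem RowsBeside.consColumn {c d : List S} {t : List (List S)} (h : Beside sgn c d)
    (ht : RowsBeside sgn t d) : RowsBeside sgn (consColumn c t) d := by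
  induction c generalizing d t with
  | nil => exact ht
  | cons a c ih =>
    cases d with
    | nil => cases t <;> trivial
    | cons b d =>
      rw [beside_cons_cons] at h
      cases t with
      | nil => exact ⟨by simpa using h.1, ih h.2 (by cases d <;> trivial)⟩
      | cons r t => exact ⟨by simpa [h.1] using ht.1, ih h.2 ht.2⟩

theorem rowsBeside_rowsOfColumns {cs : List (List S)} {d : List S} (h : ∀ c ∈ cs, Beside sgn c d) :
    RowsBeside sgn (rowsOfColumns cs) d := by
  induction cs with
  | nil => cases d <;> trivial
  | cons c cs ih =>
    rw [List.forall_mem_cons] at h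
    exact (ih h.2).consColumn h.1

theorem insertWord_columns {cs : List (List S)} (h : cs.Pairwise (Beside sgn))
    (hc : ∀ c ∈ cs, c.IsChain (ColRel sgn)) :
    insertWord sgn (cs.map List.reverse).flatten [] = rowsOfColumns cs := by
  induction cs using List.reverseRecOn with
  | nil => rfl
  | append_singleton cs d ih =>
    rw [List.pairwise_append] at h
    have hd : ∀ c ∈ cs, Beside sgn c d := fun c hc => h.2.2 c hc d (by simp)
    simp only [List.map_append, List.flatten_append, insertWord_append]
    rw [ih h.1 fun c h => hc c (by simp [h]), rowsOfColumns_concat fun c h => (hd c h).1,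
      ← insertWord_reverse_eq_addColumn (rowsBeside_rowsOfColumns hd) (hc d (by simp))]
    simp

/-! ### Recovering the columns from the rows of a juxtaposition -/

theorem length_consColumn {S : Type u} {c : List S} {t : List (List S)} (h : t.length ≤ c.length) :
    (consColumn c t).length = c.length := by
  induction c generalizing t with
  | nil => simpa [consColumn] using h
  | cons a c ih =>
    cases t with
    | nil => simpa [consColumn] using ih (t := []) (by simp)
    | cons r t => simpa [consColumn] using ih (t := t) (by simpa using h)

theorem columnReading_consColumn_zero {S : Type u} {c : List S} {t : List (List S)} (h : t.length ≤ c.length) :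
    columnReading (consColumn c t) 0 = c.reverse := by
  rw [columnReading, List.reverse_inj]
  induction c generalizing t with
  | nil =>
    obtain rfl : t = [] := by simpa using h
    rfl
  | cons a c ih =>
    cases t with
    | nil => simpa [consColumn] using ih (t := []) (by simp)
    | cons r t => simpa [consColumn] using ih (t := t) (by simpa using h)

theorem columnReading_consColumn_succ {S : Type u} {c : List S} {t : List (List S)} (h : t.length ≤ c.length)
    (j : ℕ) : columnReading (consColumn c t) (j + 1) = columnReading t j := by
  rw [columnReading, columnReading, List.reverse_inj]
  induction c generalizing t with
  | nil =>
    obtain rfl : t = [] := by simpa using h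
    rfl
  | cons a c ih =>
    cases t with
    | nil => simpa [consColumn] using ih (t := []) (by simp)
    | cons r t =>
      have := ih (t := t) (by simpa using h)
      simp [consColumn, List.filterMap_cons, this]

theorem length_rowsOfColumns_le {S : Type u} {cs : List (List S)} {n : ℕ} (h : ∀ c ∈ cs, c.length ≤ n)
    (hs : cs.Pairwise fun c d => d.length ≤ c.length) : (rowsOfColumns cs).length ≤ n := by
  cases cs with
  | nil => simp [rowsOfColumns]
  | cons c cs =>
    rw [List.pairwise_cons] at hs
    change (consColumn c (rowsOfColumns cs)).length ≤ n
    rw [length_consColumn (length_rowsOfColumns_le hs.1 hs.2)]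
    exact h c (by simp)

theorem columnReading_rowsOfColumns {S : Type u} {cs : List (List S)}
    (hs : cs.Pairwise fun c d => d.length ≤ c.length) (j : ℕ) (hj : j < cs.length) :
    columnReading (rowsOfColumns cs) j = cs[j].reverse := by
  induction cs generalizing j with
  | nil => simp at hj
  | cons c cs ih =>
    rw [List.pairwise_cons] at hs
    have h := length_rowsOfColumns_le hs.1 hs.2
    cases j with
    | zero => exact columnReading_consColumn_zero h
    | succ j =>
      exact (columnReading_consColumn_succ h j).trans (ih hs.2 j (by simpa using hj))

theorem length_headD_rowsOfColumns {S : Type u} {cs : List (List S)} (hs : ∀ c ∈ cs, c ≠ []) :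
    ((rowsOfColumns cs).headD []).length = cs.length := by
  induction cs with
  | nil => rfl
  | cons c cs ih =>
    rw [List.forall_mem_cons] at hs
    obtain ⟨a, c, rfl⟩ := List.exists_cons_of_ne_nil hs.1
    change ((consColumn (a :: c) (rowsOfColumns cs)).headD []).length = _
    rw [List.length_cons, ← ih hs.2]
    cases rowsOfColumns cs <;> rfl

/-- The word obtained by concatenating columns. -/
def columnsWord (cs : List (Column sgn)) : List S := (cs.map Column.word).flatten

theorem SuperTableau.length_columns (t : SuperTableau sgn) : t.columns.length = t.numColumns :=
  List.length_ofFn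

theorem SuperTableau.word_getElem_columns (t : SuperTableau sgn) {j : ℕ}
    (h : j < t.columns.length) : t.columns[j].word = columnReading t.rows j :=
  congrArg Column.word (List.getElem_ofFn h)

theorem Column.word_injective : Function.Injective (Column.word (sgn := sgn)) :=
  Subtype.val_injective

/-- The insertion tableau of the reading of a tableau with columns `cs` has columns `cs`. -/
theorem columns_insertionTableau_columnsWord {cs : List (Column sgn)}
    (h : cs.IsChain (Juxtaposable sgn)) :
    (insertionTableau sgn (columnsWord cs)).columns = cs := by
  set ds : List (List S) := cs.map fun c => c.word.reverse with hds
  have : IsTrans (List S) (Beside sgn) := ⟨fun _ _ _ h h' => h.trans h'⟩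
  have hp : ds.Pairwise (Beside sgn) := by
    rw [← List.isChain_iff_pairwise, hds, List.isChain_map]
    exact h.imp fun _ _ h => juxtaposable_iff_beside.1 h
  have hl := hp.imp fun h => h.1
  have hchain : ∀ d ∈ ds, d.IsChain (ColRel sgn) := by
    intro d hd
    obtain ⟨c, -, rfl⟩ := List.mem_map.1 hd
    rw [List.isChain_reverse]
    exact c.2.2
  have hne : ∀ d ∈ ds, d ≠ [] := by
    intro d hd
    obtain ⟨c, -, rfl⟩ := List.mem_map.1 hd
    exact List.reverse_ne_nil_iff.2 c.2.1
  have hw : columnsWord cs = (ds.map List.reverse).flatten := by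
    rw [columnsWord, hds, List.map_map]
    congr 2
    funext c
    simp
  have hrows : (insertionTableau sgn (columnsWord cs)).rows = rowsOfColumns ds := by
    rw [insertionTableau_rows, hw, insertWord_columns hp hchain]
  have hnum : (insertionTableau sgn (columnsWord cs)).numColumns = cs.length := by
    rw [SuperTableau.numColumns, hrows, length_headD_rowsOfColumns hne, hds, List.length_map]
  refine List.ext_getElem (by rw [SuperTableau.length_columns, hnum]) fun j h1 h2 => ?_
  apply Column.word_injective
  rw [SuperTableau.word_getElem_columns, hrows,
    columnReading_rowsOfColumns hl j (by simpa [hds] using h2)]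
  simp [hds]

/-! ### A super tableau is determined by its columns -/

theorem Above.length_le {r s : List S} (h : Above sgn r s) : s.length ≤ r.length := by
  induction r generalizing s with
  | nil => cases s <;> simp_all [Above]
  | cons a r ih =>
    cases s with
    | nil => simp
    | cons b s => simpa using ih h.2

/-- As lengths decrease, the rows without a `j`-th entry form a final segment, so filtering them out
shifts no index. -/
theorem getElem?_filterMap_of_pairwise {S : Type u} {t : List (List S)}
    (h : t.Pairwise fun r s => s.length ≤ r.length) (i j : ℕ) :
    (t.filterMap fun r => r[j]?)[i]? = t[i]?.bind fun r => r[j]? := by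
  induction t generalizing i with
  | nil => simp
  | cons r t ih =>
    rw [List.pairwise_cons] at h
    cases hr : r[j]? with
    | none =>
      have hn : ∀ s ∈ r :: t, s[j]? = none := by
        intro s hs
        rw [List.getElem?_eq_none_iff] at hr ⊢
        rcases List.mem_cons.1 hs with rfl | hs
        · exact hr
        · exact (h.1 s hs).trans hr
      rw [List.filterMap_eq_nil_iff.2 hn]
      cases hi : (r :: t)[i]? with
      | none => rfl
      | some s => simp [hn s (List.mem_of_getElem? hi)]
    | some a =>
      rw [List.filterMap_cons_some (f := fun r : List S => r[j]?) hr]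
      cases i with
      | zero => simp [hr]
      | succ i => simpa using ih h.2 i

theorem SuperTableau.pairwise_length (t : SuperTableau sgn) :
    t.rows.Pairwise fun r s => s.length ≤ r.length := by
  have : IsTrans (List S) (Above sgn) := ⟨fun _ _ _ h h' => h.trans sgn h'⟩
  exact (List.isChain_iff_pairwise.1 t.rows_above).imp fun h => h.length_le

theorem SuperTableau.reverse_columnReading_getElem? (t : SuperTableau sgn) (i j : ℕ) :
    (columnReading t.rows j).reverse[i]? = t.rows[i]?.bind fun r => r[j]? := by
  rw [columnReading, List.reverse_reverse, getElem?_filterMap_of_pairwise t.pairwise_length]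

theorem SuperTableau.columnReading_of_le (t : SuperTableau sgn) {j : ℕ} (h : t.numColumns ≤ j) :
    columnReading t.rows j = [] := by
  have hp := t.pairwise_length
  unfold SuperTableau.numColumns at h
  rw [columnReading, List.reverse_eq_nil_iff, List.filterMap_eq_nil_iff]
  intro r hr
  rw [List.getElem?_eq_none_iff]
  cases ht : t.rows with
  | nil => simp [ht] at hr
  | cons s l =>
    rw [ht] at hr h hp
    rw [List.pairwise_cons] at hp
    rcases List.mem_cons.1 hr with rfl | hr
    · exact h
    · exact (hp.1 r hr).trans h

theorem SuperTableau.eq_of_columns_eq {t t' : SuperTableau sgn} (h : t.columns = t'.columns) :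
    t = t' := by
  have hn : t.numColumns = t'.numColumns := by
    rw [← t.length_columns, h, t'.length_columns]
  have hc : ∀ j, columnReading t.rows j = columnReading t'.rows j := by
    intro j
    by_cases hj : j < t.numColumns
    · have h1 : t.columns[j]? = t'.columns[j]? := by rw [h]
      rw [List.getElem?_eq_getElem (t.length_columns ▸ hj),
        List.getElem?_eq_getElem (t'.length_columns ▸ hn ▸ hj), Option.some_inj] at h1
      rw [← t.word_getElem_columns (t.length_columns ▸ hj), h1, t'.word_getElem_columns]
    · rw [t.columnReading_of_le (not_lt.1 hj), t'.columnReading_of_le (hn ▸ not_lt.1 hj)]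
  have he : ∀ i j : ℕ, (t.rows[i]?.bind fun r => r[j]?) = t'.rows[i]?.bind fun r => r[j]? := by
    intro i j
    rw [← t.reverse_columnReading_getElem?, hc, t'.reverse_columnReading_getElem?]
  -- Rows are nonempty, so the box in column `0` detects whether the `i`-th row exists.
  have key : ∀ (s : SuperTableau sgn) (i : ℕ) (r : List S), s.rows[i]? = some r → r[0]? ≠ none := by
    intro s i r hr h0
    exact s.rows_ne_nil r (List.mem_of_getElem? hr) (by simpa using h0)
  apply SuperTableau.ext_rows
  refine List.ext_getElem? fun i => ?_
  cases h1 : t.rows[i]? with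
  | none =>
    cases h2 : t'.rows[i]? with
    | none => rfl
    | some r =>
      have := he i 0
      rw [h1, h2] at this
      exact absurd this.symm (key _ _ _ h2)
  | some r =>
    cases h2 : t'.rows[i]? with
    | none =>
      have := he i 0
      rw [h1, h2] at this
      exact absurd this (key _ _ _ h1)
    | some r' =>
      congr 1
      refine List.ext_getElem? fun j => ?_
      have := he i j
      rwa [h1, h2] at this

theorem SuperTableau.isChain_columns (t : SuperTableau sgn) :
    t.columns.IsChain (Juxtaposable sgn) := by
  rw [List.isChain_iff_getElem]
  intro j hj
  have hent := t.reverse_columnReading_getElem?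
  have hex : ∀ (i : ℕ) (b : S), (columnReading t.rows (j + 1)).reverse[i]? = some b →
      ∃ a, (columnReading t.rows j).reverse[i]? = some a ∧ RowRel sgn a b := by
    intro i b hb
    rw [hent] at hb ⊢
    obtain ⟨r, hr, hb⟩ := Option.bind_eq_some_iff.1 hb
    obtain ⟨hj', hb⟩ := List.getElem?_eq_some_iff.1 hb
    have hrow := t.rows_isSuperRow r (List.mem_of_getElem? hr)
    refine ⟨r[j], by simp [hr], ?_⟩
    rw [← hb]
    exact List.isChain_iff_getElem.1 hrow j hj'
  rw [juxtaposable_iff_beside, t.word_getElem_columns, t.word_getElem_columns]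
  refine ⟨?_, fun i a b ha hb => ?_⟩
  -- If column `j + 1` were longer, its box at the height just below the end of column `j` would
  -- have a left neighbour in column `j`.
  · by_contra! hlt
    obtain ⟨a, ha, -⟩ := hex _ _ (List.getElem?_eq_getElem hlt)
    simp at ha
  · obtain ⟨a', ha', h⟩ := hex i b hb
    rw [ha] at ha'
    cases ha'
    exact h

theorem insertionTableau_columnsWord_columns (t : SuperTableau sgn) :
    insertionTableau sgn (columnsWord t.columns) = t :=
  SuperTableau.eq_of_columns_eq (columns_insertionTableau_columnsWord t.isChain_columns)

/-- A word is equivalent to the column reading of its insertion tableau. -/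
theorem placticClass_columnsWord_insertionTableau (w : List S) :
    placticClass sgn (columnsWord (insertionTableau sgn w).columns) = placticClass sgn w := by
  -- The column reading and `w` have the same insertion tableau, hence both are equivalent to its
  -- row reading.
  rw [← placticClass_rowReading_insertionTableau, insertionTableau_columnsWord_columns,
    placticClass_rowReading_insertionTableau]

/-! ### Inserting a column word in a row -/

theorem mem_insertRow_self (x : S) (r : List S) : x ∈ (insertRow sgn x r).1 := by
  induction r with
  | nil => simp [insertRow_nil]
  | cons a r ih =>
    by_cases h : ColRel sgn x a
    · simp [insertRow_cons_of_colRel h]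
    · simp [insertRow_cons_of_rowRel (rowRel_of_not_colRel h), ih]

theorem length_insertRow_of_mem {x y : S} {r : List S} (hx : x ∈ r) (h : ColRel sgn y x) :
    (insertRow sgn y r).1.length = r.length := by
  induction r with
  | nil => simp at hx
  | cons a r ih =>
    by_cases hya : ColRel sgn y a
    · simp [insertRow_cons_of_colRel hya]
    · rcases List.mem_cons.1 hx with rfl | hx
      · exact absurd h hya
      · simp [insertRow_cons_of_rowRel (rowRel_of_not_colRel hya), ih hx]

/-- The letter just inserted can always be bumped by the next letter of the column. A column word
thus lengthens a row by at most one box. -/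
theorem length_insertRowWord_of_mem {x : S} {p r : List S} (hx : x ∈ r)
    (hp : IsSuperColumn sgn (x :: p)) : (insertRowWord sgn p r).1.length = r.length := by
  induction p generalizing x r with
  | nil => rfl
  | cons y p ih =>
    have h := List.isChain_cons_cons.1 hp
    rw [insertRowWord, ih (mem_insertRow_self y r) h.2, length_insertRow_of_mem hx h.1]

/-- By `exists_bumped_of_colRel`, only the first letter can fail to bump, and successive bumped
letters stay in column order. -/
theorem isSuperColumn_insertRowWord {p r : List S} (hp : IsSuperColumn sgn p)
    (hr : IsSuperRow sgn r) : IsSuperColumn sgn (insertRowWord sgn p r).2 := by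
  induction p generalizing r with
  | nil => exact List.isChain_nil
  | cons x p ih =>
    have h := ih hp.tail (isSuperRow_insertRow sgn x hr)
    rw [insertRowWord]
    cases hb : (insertRow sgn x r).2 with
    | none => exact h
    | some b =>
      cases p with
      | nil => exact List.isChain_singleton b
      | cons y p =>
        obtain ⟨c, h1, -, h3⟩ := exists_bumped_of_colRel hr (List.isChain_cons_cons.1 hp).1
        rw [insertRowWord, h1] at h ⊢
        exact List.isChain_cons_cons.2 ⟨h3 b hb, h⟩

theorem head_insertRowWord (p : List S) (a : S) (r : List S) :
    ∃ c s, (insertRowWord sgn p (a :: r)).1 = c :: s ∧ (c = a ∨ c ∈ p ∧ ColRel sgn c a) := by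
  induction p generalizing a r with
  | nil => exact ⟨a, r, rfl, Or.inl rfl⟩
  | cons x p ih =>
    rw [insertRowWord]
    by_cases h : ColRel sgn x a
    · rw [insertRow_cons_of_colRel h]
      obtain ⟨c, s, h1, h2⟩ := ih x r
      refine ⟨c, s, h1, Or.inr ?_⟩
      rcases h2 with rfl | ⟨h2, h3⟩
      · exact ⟨by simp, h⟩
      · exact ⟨by simp [h2], h3.trans sgn h⟩
    · rw [insertRow_cons_of_rowRel (rowRel_of_not_colRel h)]
      obtain ⟨c, s, h1, h2⟩ := ih a (insertRow sgn x r).1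
      refine ⟨c, s, h1, ?_⟩
      simp only [List.mem_cons]
      tauto

theorem insertRowWord_concat_nil {p : List S} {x : S} (h : IsSuperColumn sgn (p ++ [x])) :
    insertRowWord sgn (p ++ [x]) [] = ([x], p) := by
  suffices H : ∀ (a : S) (p : List S), IsSuperColumn sgn (a :: p ++ [x]) →
      insertRowWord sgn (p ++ [x]) [a] = ([x], a :: p) by
    cases p with
    | nil => rfl
    | cons a p => simp [insertRowWord, insertRow_nil, H a p h]
  intro a p h
  induction p generalizing a with
  | nil =>
    have h' := (List.isChain_cons_cons.1 h).1
    simp [insertRowWord, insertRow_cons_of_colRel h']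
  | cons b p ih =>
    have h' := List.isChain_cons_cons.1 h
    simp [insertRowWord, insertRow_cons_of_colRel h'.1, ih b h'.2]

theorem insertWord_ne_nil {p : List S} (hp : p ≠ []) : insertWord sgn p [] ≠ [] := by
  obtain ⟨x, p, rfl⟩ := List.exists_cons_of_ne_nil hp
  simp [insertWord_cons_nil]

/-- If inserting a column in a column does not create a new row, then the columns may be
juxtaposed. -/
theorem beside_of_length_insertWord_le {c d : List S} (hc : c.IsChain (ColRel sgn))
    (hd : d.IsChain (ColRel sgn))
    (h : (insertWord sgn d.reverse (consColumn c [])).length ≤ c.length) : Beside sgn c d := by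
  induction c generalizing d with
  | nil =>
    cases d with
    | nil => exact beside_nil _
    | cons e d =>
      exact absurd (List.length_eq_zero_iff.1 (Nat.le_zero.1 h)) (insertWord_ne_nil (by simp))
  | cons a c ih =>
    cases d with
    | nil => exact beside_nil _
    | cons e d =>
      have hd' : IsSuperColumn sgn (d.reverse ++ [e]) := by
        rw [← List.reverse_cons]
        exact List.isChain_reverse.2 hd
      have hp : (e :: d).Pairwise (ColRel sgn) := by
        have : IsTrans S (ColRel sgn) := ⟨fun _ _ _ h h' => h.trans sgn h'⟩
        exact List.isChain_iff_pairwise.1 hd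
      rw [List.pairwise_cons] at hp
      rw [List.reverse_cons, consColumn, insertWord_cons_rows, List.length_cons, List.length_cons,
        Nat.add_le_add_iff_right] at h
      -- Suppose that the top letter `e` of the right column, inserted last, could bump `a`. It then
      -- bumps the current head `l`, which is `a` or precedes `a` in column order. As the last
      -- bumped letter, `l` is the top of the column sent to the lower rows. By induction that
      -- column fits beside `c`, so the head `b` of `c` is in row order with `l`, although `l`, like
      -- `a`, precedes `b` in column order.
      by_cases hea : ColRel sgn e a
      · exfalso
        have hcol := isSuperColumn_insertRowWord hd' (List.isChain_singleton (R := RowRel sgn) a)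
        obtain ⟨l, s, h1, h2⟩ := head_insertRowWord (sgn := sgn) d.reverse a []
        have hel : ColRel sgn e l := by
          rcases h2 with rfl | ⟨h2, -⟩
          · exact hea
          · exact hp.1 l (by simpa using h2)
        have hb : (insertRowWord sgn (d.reverse ++ [e]) [a]).2 =
            (insertRowWord sgn d.reverse [a]).2 ++ [l] := by
          rw [insertRowWord_append, h1]
          simp [insertRowWord, insertRow_cons_of_colRel hel]
        have hB := ih (d := (insertRowWord sgn (d.reverse ++ [e]) [a]).2.reverse) hc.tail
          (List.isChain_reverse.2 hcol) (by rwa [List.reverse_reverse])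
        rw [hb, List.reverse_append] at hB
        cases c with
        | nil => simpa using hB.1
        | cons b c =>
          have hbl := (beside_cons_cons.1 hB).1
          have hab := (List.isChain_cons_cons.1 hc).1
          refine hbl.not_colRel ?_
          rcases h2 with rfl | ⟨-, h2⟩
          · exact hab
          · exact h2.trans sgn hab
      · have hae := rowRel_of_not_colRel hea
        -- Otherwise every letter passes `a`; only `e` stays beside it and `d.reverse` is bumped,
        -- which is the same problem for `c` and `d`.
        have hall : ∀ x ∈ d.reverse ++ [e], RowRel sgn a x := by
          intro x hx
          rcases List.mem_append.1 hx with hx | hx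
          · exact hae.rowRel_of_colRel (hp.1 x (by simpa using hx))
          · simpa [List.mem_singleton.1 hx] using hae
        rw [insertRowWord_cons_of_rowRel hall, insertRowWord_concat_nil hd'] at h
        exact beside_cons_cons.2 ⟨hae, ih hc.tail hd.tail h⟩

/-! ### The insertion tableau of the product of two columns -/

theorem Column.insertWord_word (u : Column sgn) :
    insertWord sgn u.word [] = consColumn u.word.reverse [] := by
  have h := insertWord_columns (sgn := sgn) (cs := [u.word.reverse]) (by simp)
    (by rw [List.forall_mem_singleton]; exact List.isChain_reverse.2 u.2.2)
  simpa [rowsOfColumns] using h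

theorem Column.rows_insertionTableau (u v : Column sgn) :
    (insertionTableau sgn (u.word ++ v.word)).rows =
      insertWord sgn v.word (consColumn u.word.reverse []) := by
  rw [insertionTableau_rows, insertWord_append, u.insertWord_word]

/-- The top letter `a` of `u` and the bottom letter `x` of `v` decide. If `x` may stand above `a`,
then `uv` is a column. If not, `x` is placed to the right of `a` and the rest of `v` does not
lengthen the top row. -/
theorem columns_insertionTableau_pair (u v : Column sgn) :
    (∃ w : Column sgn, w.word = u.word ++ v.word ∧
      (insertionTableau sgn (u.word ++ v.word)).columns = [w]) ∨
    ∃ w w' : Column sgn, (insertionTableau sgn (u.word ++ v.word)).columns = [w, w'] := by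
  obtain ⟨a, c, hu⟩ := List.exists_cons_of_ne_nil (List.reverse_ne_nil_iff.2 u.2.1)
  obtain ⟨x, p, hv⟩ := List.exists_cons_of_ne_nil v.2.1
  change u.word.reverse = a :: c at hu
  change v.word = x :: p at hv
  have hvc : IsSuperColumn sgn (x :: p) := hv ▸ v.2.2
  have hu' : u.word = c.reverse ++ [a] := by rw [← List.reverse_cons, ← hu, List.reverse_reverse]
  by_cases hxa : ColRel sgn x a
  · left
    have hcol : IsSuperColumn sgn (u.word ++ v.word) := by
      refine List.isChain_append.2 ⟨u.2.2, v.2.2, ?_⟩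
      intro b hb y hy
      rw [hu'] at hb
      rw [hv] at hy
      simp only [List.getLast?_append, List.getLast?_singleton, Option.some_or,
        Option.mem_def, Option.some_inj, List.head?_cons] at hb hy
      subst hb hy
      exact hxa
    let w : Column sgn := ⟨u.word ++ v.word, by simp [hv], hcol⟩
    refine ⟨w, rfl, ?_⟩
    have h := columns_insertionTableau_columnsWord (List.isChain_singleton (R := Juxtaposable sgn) w)
    have hw : columnsWord [w] = u.word ++ v.word := List.append_nil _
    rwa [hw] at h
  · right
    have hn : (insertionTableau sgn (u.word ++ v.word)).columns.length = 2 := by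
      rw [SuperTableau.length_columns, SuperTableau.numColumns, u.rows_insertionTableau v, hu,
        consColumn, insertWord_cons_rows, List.headD_cons, hv, insertRowWord,
        length_insertRowWord_of_mem (mem_insertRow_self x _) hvc,
        insertRow_cons_of_rowRel (rowRel_of_not_colRel hxa)]
      rfl
    exact List.length_eq_two.1 hn

theorem SuperTableau.length_columnReading_zero (t : SuperTableau sgn) :
    (columnReading t.rows 0).length = t.rows.length := by
  have h : ∀ l : List (List S), (∀ r ∈ l, r ≠ []) →
      (l.filterMap fun r => r[0]?).length = l.length := by
    intro l
    induction l with
    | nil => simp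
    | cons r l ih =>
      intro h
      rw [List.forall_mem_cons] at h
      obtain ⟨a, s, rfl⟩ := List.exists_cons_of_ne_nil h.1
      simp [ih h.2]
  rw [columnReading, List.length_reverse, h _ t.rows_ne_nil]

/-- The length of the first column is the number of rows, so without lengthening no new row would
appear and the pair would be juxtaposable. -/
theorem length_lt_length_first_column {u v w : Column sgn} {l : List (Column sgn)}
    (h : ¬ Juxtaposable sgn u v)
    (hw : (insertionTableau sgn (u.word ++ v.word)).columns = w :: l) :
    u.word.length < w.word.length := by
  by_contra! hle
  apply h
  rw [juxtaposable_iff_beside]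
  refine beside_of_length_insertWord_le (List.isChain_reverse.2 u.2.2)
    (List.isChain_reverse.2 v.2.2) ?_
  have h0 := (insertionTableau sgn (u.word ++ v.word)).word_getElem_columns
    (j := 0) (by rw [hw]; simp)
  simp only [hw, List.getElem_cons_zero] at h0
  rw [List.reverse_reverse, ← u.rows_insertionTableau v, List.length_reverse,
    ← SuperTableau.length_columnReading_zero, ← h0]
  exact hle

/-! ### Termination -/

theorem columnsWord_append (a b : List (Column sgn)) :
    columnsWord (a ++ b) = columnsWord a ++ columnsWord b := by
  simp [columnsWord]

/-- The sum of the lengths of the columns, weighted by their positions. -/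
def positionWeight : List (Column sgn) → ℕ
  | [] => 0
  | _ :: l => positionWeight l + (columnsWord l).length

theorem positionWeight_append (a b : List (Column sgn)) :
    positionWeight (a ++ b) =
      positionWeight a + positionWeight b + a.length * (columnsWord b).length := by
  induction a with
  | nil => simp [positionWeight]
  | cons c a ih =>
    simp only [List.cons_append, positionWeight, ih, columnsWord_append, List.length_append,
      List.length_cons]
    ring

theorem length_columnsWord_insertionTableau (w : List S) :
    (columnsWord (insertionTableau sgn w).columns).length = w.length :=
  length_eq_of_placticClass_eq (placticClass_columnsWord_insertionTableau w)

/-- Positions count from `0`, so the source weighs `|v|` and the target `0` or `|w'|`. Since `|w| +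
|w'| = |u| + |v|` and `|w| > |u|`, the weight drops. -/
theorem positionWeight_columns_lt {u v : Column sgn} (h : ¬ Juxtaposable sgn u v) :
    positionWeight (insertionTableau sgn (u.word ++ v.word)).columns < positionWeight [u, v] := by
  have hlen := length_columnsWord_insertionTableau (sgn := sgn) (u.word ++ v.word)
  have hv : 0 < v.word.length := List.length_pos_iff.2 v.2.1
  rcases columns_insertionTableau_pair u v with ⟨w, -, hw⟩ | ⟨w, w', hw⟩
  · rw [hw]
    simpa [positionWeight, columnsWord] using hv
  · have hlt := length_lt_length_first_column h hw
    rw [hw] at hlen ⊢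
    simp only [columnsWord, List.map_cons, List.map_nil, List.flatten_cons, List.flatten_nil,
      List.append_nil, List.length_append] at hlen
    simp only [positionWeight, columnsWord, List.map_cons, List.map_nil, List.flatten_cons,
      List.flatten_nil, List.append_nil, List.length_nil]
    omega

theorem columnPolygraph_step_iff {a b : FreeMonoid (Column sgn)} :
    (columnPolygraph sgn).Step a b ↔
      ∃ (l l' : List (Column sgn)) (u v : Column sgn), ¬ Juxtaposable sgn u v ∧
        a.toList = l ++ ([u, v] ++ l') ∧
        b.toList = l ++ ((insertionTableau sgn (u.word ++ v.word)).columns ++ l') := by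
  constructor
  · rintro ⟨l, l', ⟨⟨u, v⟩, h⟩, rfl, rfl⟩
    exact ⟨l.toList, l'.toList, u, v, h, List.append_assoc _ _ _, List.append_assoc _ _ _⟩
  · rintro ⟨l, l', u, v, h, ha, hb⟩
    exact ⟨FreeMonoid.ofList l, FreeMonoid.ofList l', ⟨⟨u, v⟩, h⟩,
      ha.trans (List.append_assoc _ _ _).symm, hb.trans (List.append_assoc _ _ _).symm⟩

theorem positionWeight_lt_of_step {a b : FreeMonoid (Column sgn)}
    (h : (columnPolygraph sgn).Step a b) : positionWeight b.toList < positionWeight a.toList := by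
  obtain ⟨l, l', u, v, h, ha, hb⟩ := columnPolygraph_step_iff.1 h
  have hw := positionWeight_columns_lt h
  have hlen : (columnsWord (insertionTableau sgn (u.word ++ v.word)).columns).length =
      (columnsWord [u, v]).length := by
    rw [length_columnsWord_insertionTableau]
    simp [columnsWord]
  have hn : (insertionTableau sgn (u.word ++ v.word)).columns.length ≤ 2 := by
    rcases columns_insertionTableau_pair u v with ⟨w, -, hw⟩ | ⟨w, w', hw⟩ <;> simp [hw]
  -- A target of at most two columns does not move the suffix `l'` to the right.
  have hm := Nat.mul_le_mul_right (columnsWord l').length hn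
  simp only [ha, hb, positionWeight_append, columnsWord_append, List.length_append, hlen]
  have h2 : [u, v].length = 2 := rfl
  rw [h2]
  omega

theorem columnPolygraph_terminating : (columnPolygraph sgn).Terminating := by
  intro H
  obtain ⟨f, hf⟩ : ∃ f : ℕ → FreeMonoid (Column sgn),
    ∀ n, (columnPolygraph sgn).Step (f n) (f (n + 1)) := H
  have h : ∀ n, positionWeight (f n).toList + n ≤ positionWeight (f 0).toList := by
    intro n
    induction n with
    | zero => exact le_rfl
    | succ n ih =>
      have := positionWeight_lt_of_step (hf n)
      omega
  have := h (positionWeight (f 0).toList + 1)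
  omega

/-! ### Normal forms and confluence -/

theorem exists_reflTransGen_isChain (a : FreeMonoid (Column sgn)) :
    ∃ b, Relation.ReflTransGen (columnPolygraph sgn).Step a b ∧
      b.toList.IsChain (Juxtaposable sgn) := by
  induction hn : positionWeight a.toList using Nat.strong_induction_on generalizing a with
  | _ n ih =>
    by_cases h : a.toList.IsChain (Juxtaposable sgn)
    · exact ⟨a, .refl, h⟩
    · rw [List.isChain_iff_forall_rel_of_append_cons_cons] at h
      push Not at h
      obtain ⟨u, v, l, l', ha, huv⟩ := h
      have hs : (columnPolygraph sgn).Step a (FreeMonoid.ofList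
          (l ++ ((insertionTableau sgn (u.word ++ v.word)).columns ++ l'))) :=
        columnPolygraph_step_iff.2 ⟨l, l', u, v, huv, ha, rfl⟩
      obtain ⟨b, hb, hc⟩ := ih _ (hn ▸ positionWeight_lt_of_step hs) _ rfl
      exact ⟨b, .head hs hb, hc⟩

theorem placticClass_columnsWord_of_step {a b : FreeMonoid (Column sgn)}
    (h : (columnPolygraph sgn).Step a b) :
    placticClass sgn (columnsWord a.toList) = placticClass sgn (columnsWord b.toList) := by
  obtain ⟨l, l', u, v, h, ha, hb⟩ := columnPolygraph_step_iff.1 h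
  have huv : columnsWord [u, v] = u.word ++ v.word := by simp [columnsWord]
  simp only [ha, hb, columnsWord_append, placticClass_append,
    placticClass_columnsWord_insertionTableau, huv]

theorem placticClass_columnsWord_of_reflTransGen {a b : FreeMonoid (Column sgn)}
    (h : Relation.ReflTransGen (columnPolygraph sgn).Step a b) :
    placticClass sgn (columnsWord a.toList) = placticClass sgn (columnsWord b.toList) := by
  induction h with
  | refl => rfl
  | tail _ h ih => exact ih.trans (placticClass_columnsWord_of_step h)

/-- Two products of columns with equivalent readings have a common reduct. -/
theorem exists_common_reduct {a b : FreeMonoid (Column sgn)}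
    (h : placticClass sgn (columnsWord a.toList) = placticClass sgn (columnsWord b.toList)) :
    ∃ d, Relation.ReflTransGen (columnPolygraph sgn).Step a d ∧
      Relation.ReflTransGen (columnPolygraph sgn).Step b d := by
  obtain ⟨c, hac, hc⟩ := exists_reflTransGen_isChain a
  obtain ⟨d, hbd, hd⟩ := exists_reflTransGen_isChain b
  have hcd : placticClass sgn (columnsWord c.toList) = placticClass sgn (columnsWord d.toList) :=
    (placticClass_columnsWord_of_reflTransGen hac).symm.trans
      (h.trans (placticClass_columnsWord_of_reflTransGen hbd))
  -- A normal form is the list of columns of the insertion tableau of its reading, so the plactic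
  -- class determines it.
  have e : c.toList = d.toList := by
    rw [← columns_insertionTableau_columnsWord hc, ← columns_insertionTableau_columnsWord hd,
      insertionTableau_eq_of_placticClass_eq hcd]
  obtain rfl : c = d := FreeMonoid.toList.injective e
  exact ⟨c, hac, hbd⟩

theorem columnPolygraph_confluent : (columnPolygraph sgn).Confluent := fun _ _ _ hb hc =>
  exists_common_reduct ((placticClass_columnsWord_of_reflTransGen hb).symm.trans
    (placticClass_columnsWord_of_reflTransGen hc))

/-! ### The presented monoid -/

theorem mk_eq_of_reflTransGen {P : TwoPolygraph.{u, v}} {a b : FreeMonoid P.Cell1}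
    (h : Relation.ReflTransGen P.Step a b) :
    PresentedMonoid.mk P.Rel a = PresentedMonoid.mk P.Rel b := by
  induction h with
  | refl => rfl
  | tail _ h ih =>
    obtain ⟨w, w', α, rfl, rfl⟩ := h
    have hα : P.Rel (P.src α) (P.tgt α) := ⟨α, rfl, rfl⟩
    simp only [ih, map_mul, PresentedMonoid.mk_eq_mk_of_rel hα]

theorem lift_placticClass_word (a : FreeMonoid (Column sgn)) :
    FreeMonoid.lift (fun u : Column sgn => placticClass sgn u.word) a =
      placticClass sgn (columnsWord a.toList) := by
  induction a using FreeMonoid.inductionOn' with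
  | one => rfl
  | of_mul u a ih =>
    rw [map_mul, ih]
    rfl

theorem lift_placticClass_word_of_rel (a b : FreeMonoid (Column sgn))
    (h : (columnPolygraph sgn).Rel a b) :
    FreeMonoid.lift (fun u : Column sgn => placticClass sgn u.word) a =
      FreeMonoid.lift (fun u : Column sgn => placticClass sgn u.word) b := by
  rw [lift_placticClass_word, lift_placticClass_word]
  obtain ⟨α, ha, hb⟩ := h
  exact placticClass_columnsWord_of_step
    ⟨1, 1, α, by rw [ha, one_mul, mul_one], by rw [hb, one_mul, mul_one]⟩

variable (sgn) in
/-- The homomorphism from the monoid presented by the column polygraph to the super plactic monoid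
sending each column to the class of its reading. -/
noncomputable def columnPresentationHom :
    (columnPolygraph sgn).PresentedBy →* SuperPlacticMonoid sgn :=
  PresentedMonoid.lift (fun u : Column sgn => placticClass sgn u.word)
    lift_placticClass_word_of_rel

theorem columnPresentationHom_mk (a : FreeMonoid (Column sgn)) :
    columnPresentationHom sgn (PresentedMonoid.mk (columnPolygraph sgn).Rel a) =
      placticClass sgn (columnsWord a.toList) :=
  lift_placticClass_word a

/-- Products with the same image have a common reduct, hence are equal; each class is reached by the
columns of an insertion tableau. -/
theorem columnPresentationHom_bijective : Function.Bijective (columnPresentationHom sgn) := by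
  constructor
  · intro x y h
    obtain ⟨a, rfl⟩ := PresentedMonoid.surjective_mk x
    obtain ⟨b, rfl⟩ := PresentedMonoid.surjective_mk y
    have h' := (columnPresentationHom_mk a).symm.trans (h.trans (columnPresentationHom_mk b))
    obtain ⟨d, had, hbd⟩ := exists_common_reduct h'
    exact (mk_eq_of_reflTransGen had).trans (mk_eq_of_reflTransGen hbd).symm
  · intro y
    obtain ⟨w, rfl⟩ := PresentedMonoid.surjective_mk y
    let a : FreeMonoid (Column sgn) :=
      FreeMonoid.ofList (insertionTableau sgn (FreeMonoid.toList (α := S) w)).columns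
    exact ⟨PresentedMonoid.mk _ a,
      (columnPresentationHom_mk a).trans (placticClass_columnsWord_insertionTableau _)⟩

end SuperPlactic

theorem mainTheorem1 {S : Type*} [LinearOrder S] [Countable S] (sgn : S → ZMod 2) :
    -- the rules have the announced form: the target is `c_{uv}` or `c_w c_{w'}`
    (∀ u v : SuperPlactic.Column sgn, ¬ SuperPlactic.Juxtaposable sgn u v →
      (∃ w : SuperPlactic.Column sgn, w.word = u.word ++ v.word ∧
        (SuperPlactic.insertionTableau sgn (u.word ++ v.word)).columns = [w]) ∨
      (∃ w w' : SuperPlactic.Column sgn,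
        (SuperPlactic.insertionTableau sgn (u.word ++ v.word)).columns = [w, w'])) ∧
    -- the polygraph is convergent
    (SuperPlactic.columnPolygraph sgn).Convergent ∧
    -- the monoid it presents is the super plactic monoid, `c_u` standing for the class of `u`
    (∃ e : (SuperPlactic.columnPolygraph sgn).PresentedBy ≃* SuperPlactic.SuperPlacticMonoid sgn,
      ∀ u : SuperPlactic.Column sgn,
        e (PresentedMonoid.of (SuperPlactic.columnPolygraph sgn).Rel u) =
          SuperPlactic.placticClass sgn u.word) := by
  refine ⟨fun u v _ => SuperPlactic.columns_insertionTableau_pair u v,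
    ⟨SuperPlactic.columnPolygraph_terminating, SuperPlactic.columnPolygraph_confluent⟩,
    MulEquiv.ofBijective (SuperPlactic.columnPresentationHom sgn)
      SuperPlactic.columnPresentationHom_bijective, fun _ => rfl⟩
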